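/- Contextual symmetric stochastic block model (CSSBM). Given a partition $z\in[K]^n$ of $n$ nodes into $K$ communities, centers $\mu_1,\dots,\mu_K\in\mathbb R^d$ and $p,q\in[0,1]$, one observes a symmetric adjacency matrix $A$ with zero diagonal whose entries $A_{ij}$, $i<j$, are independent Bernoulli variables with parameter $p$ if $z_i=z_j$ and $q$ otherwise, and, independently of $A$, independent covariates $X_i\sim\mathcal N(\mu_{z_i},I_d)$, $i\in[n]$. Write $\theta=(z,\mu,p,q)$. For $\hat z,z\in[K]^n$ put $r(\hat z,z)=\min_{\sigma\in\mathfrak S_K}\frac1n\sum_{i\in[n]}\mathbf 1_{\{\sigma(\hat z_i)\ne z_i\}}$. Theorem. For each $n$ let $K=K_n\ge 2$, $d=d_n$, $\mu=\mu^{(n)}$, and $p=p'\frac{\log n}{n}$, $q=q'\frac{\log n}{n}$ with $p'=p'_n>0$, $q'=q'_n>0$, and set \[ \tilde\Delta^2=\frac18\min_{k\neq k'}\|\mu_k-\mu_{k'}\|^2+\frac{\log n}{K}\bigl(\sqrt{p'}-\sqrt{q'}\bigr)^2 . \] Assume that, as $n\to\infty$, $p\to 0$, $q\to0$, $n/K\to\infty$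 and $\tilde\Delta^2/\log K\to\infty$. Let $\alpha>1$ be fixed, and let $\Theta=\Theta_n$ be any parameter set that contains all $\theta=(z,\mu^{(n)},p,q)$ (when $p,q\in[0,1]$) with $\frac{n}{\alpha K}\le \#\{i:z_i=k\}\le\frac{\alpha n}{K}$ for all $k\in[K]$ (for example, the set of exactly these $\theta$). Then \[ \inf_{\hat z}\sup_{\theta\in\Theta}\mathbb E_\theta\, r(\hat z,z)\ \ge\ \exp\bigl(-(1+o(1))\tilde\Delta^2\bigr)\qquad(n\to\infty), \] that is, there is a sequence $\varepsilon_n\to0$ such that the left-hand side is at least $\exp(-(1+\varepsilon_n)\tilde\Delta^2)$ for all large $n$. The infimum is over all estimators $\hat z=\hat z(A,X)\in[K]^n$ (measurable functions of the data, which may depend on $n$, $\Theta_n$, $\mu^{(n)}$, $p$ and $q$). -/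

import Mathlib

open MeasureTheory ProbabilityTheory Filter Topology

namespace CSSBM

/-- The unordered pairs of distinct nodes, written as ordered pairs `i < j`. -/
abbrev Edge (n : ℕ) : Type := {e : Fin n × Fin n // e.1 < e.2}

/-- What the statistician observes: the upper-triangular part of the symmetric, zero-diagonal
0-1 adjacency matrix `A`, and a covariate vector in `ℝ^d` for each of the `n` nodes. -/
abbrev Data (n d : ℕ) : Type := (Edge n → Bool) × (Fin n → EuclideanSpace ℝ (Fin d))

/-- A parameter `θ` of the contextual symmetric stochastic block model with `n` nodes, `K`
communities and covariates in `ℝ^d`: the partition `z`, the centers `μ_1, …, μ_K`, and the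
within-community and between-community edge probabilities `p` and `q`. -/
structure Param (n K d : ℕ) where
  z : Fin n → Fin K
  μ : Fin K → EuclideanSpace ℝ (Fin d)
  p : unitInterval
  q : unitInterval

/-- The probability that nodes `i` and `j` are linked. -/
def Param.edgeProb {n K d : ℕ} (θ : Param n K d) (i j : Fin n) : unitInterval :=
  if θ.z i = θ.z j then θ.p else θ.q

/-- The law of the data: the edges are independent Bernoulli variables, the covariates are
independent with `X_i ∼ N(μ_{z_i}, I_d)`, and the graph and the covariates are independent. -/
noncomputable def Param.law {n K d : ℕ} (θ : Param n K d) : Measure (Data n d) :=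
  (Measure.pi fun e : Edge n => bernoulliMeasure true false (θ.edgeProb e.1.1 e.1.2)).prod
    (Measure.pi fun i : Fin n => multivariateGaussian (θ.μ (θ.z i)) 1)

/-- The misclustering rate: the normalized Hamming distance between the two partitions, minimized
over the relabellings of the communities. -/
noncomputable def misclustering {n K : ℕ} (z' z : Fin n → Fin K) : ℝ :=
  ⨅ σ : Equiv.Perm (Fin K), (hammingDist (fun i => σ (z' i)) z : ℝ) / n

/-- The expected misclustering rate `E_θ r(ẑ, z)` of the estimator `zhat`. -/
noncomputable def risk {n K d : ℕ} (zhat : Data n d → Fin n → Fin K) (θ : Param n K d) :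
    ENNReal :=
  ∫⁻ ω, ENNReal.ofReal (misclustering (zhat ω) θ.z) ∂θ.law

/-- `inf_ẑ sup_{θ ∈ Θ} E_θ r(ẑ, z)`, the infimum being over all (measurable) estimators. -/
noncomputable def minimaxRisk {n K d : ℕ} (Θ : Set (Param n K d)) : ENNReal :=
  ⨅ (zhat : Data n d → Fin n → Fin K) (_ : Measurable zhat), ⨆ θ ∈ Θ, risk zhat θ

/-- The size `n_k` of community `k`. -/
def communitySize {n K : ℕ} (z : Fin n → Fin K) (k : Fin K) : ℕ :=
  (Finset.univ.filter fun i => z i = k).card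

/-- `n / (α K) ≤ n_k ≤ α n / K` for every community `k`. -/
def Balanced {n K : ℕ} (α : ℝ) (z : Fin n → Fin K) : Prop :=
  ∀ k, (n : ℝ) / (α * K) ≤ communitySize z k ∧ (communitySize z k : ℝ) ≤ α * n / K

/-- The parameters with the given centers and edge probabilities, and an arbitrary approximately
balanced partition. -/
def balancedParams {n K d : ℕ} (α : ℝ) (μ : Fin K → EuclideanSpace ℝ (Fin d)) (p q : ℝ) :
    Set (Param n K d) :=
  {θ | Balanced α θ.z ∧ θ.μ = μ ∧ (θ.p : ℝ) = p ∧ (θ.q : ℝ) = q}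

/-- `min_{k ≠ k'} ‖μ_k - μ_{k'}‖²`. -/
noncomputable def minSepSq {K d : ℕ} (μ : Fin K → EuclideanSpace ℝ (Fin d)) : ℝ :=
  ⨅ k : {k : Fin K × Fin K // k.1 ≠ k.2}, ‖μ k.1.1 - μ k.1.2‖ ^ 2

/-- The signal-to-noise ratio
`Δ̃² = (1/8) min_{k ≠ k'} ‖μ_k - μ_{k'}‖² + (log n / K) (√p' - √q')²`. -/
noncomputable def snrSq {K d : ℕ} (n : ℕ) (μ : Fin K → EuclideanSpace ℝ (Fin d))
    (p' q' : ℝ) : ℝ :=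
  1 / 8 * minSepSq μ + Real.log n / K * (√p' - √q') ^ 2

end CSSBM

namespace CSSBM

/-! The proof is Assouad's method on a small hypercube of partitions. Let `a`, `b` be the two
closest centers, start from a nearly equal partition, and leave open, for about `δ n / K` nodes
forming a set `T`, whether they belong to `a` or `b`. All these partitions are balanced, and `T` is
so small compared with every community that relabelling cannot bring two of them closer
(`hammingDist_le_hammingDist_perm`). Averaging over the cube (`le_iSup_risk`) bounds the risk below
by `|T| / (4 n)` times a lower bound for the total error of testing two partitions that differ at
one node.

For such a test, write `L` for the log-likelihood ratio and let `Q` be proportional to the geometric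
mean of the two laws, with total mass `exp (-κ)` before normalization (the Hellinger affinity). The
sum of the two errors is at least the integral of the smaller density, `exp (-κ) E_Q exp (-|L| /
2)`, which by Jensen is at least `exp (-κ - √(v + m ^ 2) / 2)`. The quantities `κ`, `m`, `v` add
over independent coordinates. About `2 n / K` edges change law, each contributing about `(√p - √q) ^
2 / 2` to `κ` because `p, q → 0`; the covariate contributes `‖μ a - μ b‖ ^ 2 / 8`. The total is the
signal-to-noise ratio.

The rest is of lower order: edges towards `a` and `b` have opposite means, so `m` sees only the
imbalance of the two communities; `v` is of the order of the ratio, so its square root is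
negligible; and the prefactor, of order `δ / K`, costs only `log K` plus a constant. -/

/-- `P` and `P'` have the densities `exp (± L / 2 - κ)` with respect to a common probability
measure, under which the log-likelihood ratio `L` has mean `m` and variance at most `v`. -/
def HellingerTilt {Ω : Type*} [MeasurableSpace Ω] (P P' : Measure Ω) (κ m v : ℝ) : Prop :=
  ∃ (Q : Measure Ω) (L : Ω → ℝ), IsProbabilityMeasure Q ∧ Measurable L ∧ MemLp L 2 Q ∧
    P = Q.withDensity (fun x => ENNReal.ofReal (Real.exp (L x / 2 - κ))) ∧
    P' = Q.withDensity (fun x => ENNReal.ofReal (Real.exp (-L x / 2 - κ))) ∧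
    ∫ x, L x ∂Q = m ∧ variance L Q ≤ v

/-! ### Calculus of tilts: swapping, isomorphisms, products, and the testing bound. -/

namespace HellingerTilt

variable {Ω Ω' : Type*} [MeasurableSpace Ω] [MeasurableSpace Ω']

theorem refl (P : Measure Ω) [hP : IsProbabilityMeasure P] : HellingerTilt P P 0 0 0 := by
  refine ⟨P, fun _ => 0, hP, measurable_const, memLp_const 0, ?_, ?_, ?_, ?_⟩
  · simp
  · simp
  · simp
  · exact (variance_zero P).le

theorem symm {P P' : Measure Ω} {κ m v : ℝ} (h : HellingerTilt P P' κ m v) :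
    HellingerTilt P' P κ (-m) v := by
  obtain ⟨Q, L, hQ, hL, hL2, hP, hP', hm, hv⟩ := h
  refine ⟨Q, fun x => -L x, hQ, hL.neg, hL2.neg, hP', ?_, ?_, ?_⟩
  · simpa using hP
  · rw [integral_neg, hm]
  · have : variance (fun x => -L x) Q = variance L Q := variance_neg
    rw [this]; exact hv

theorem map {P P' : Measure Ω} {κ m v : ℝ} (h : HellingerTilt P P' κ m v) (e : Ω ≃ᵐ Ω') :
    HellingerTilt (P.map e) (P'.map e) κ m v := by
  obtain ⟨Q, L, hQ, hL, hL2, hP, hP', hm, hv⟩ := h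
  have key : ∀ f : Ω → ENNReal, Measurable f →
      (Q.withDensity f).map e = (Q.map e).withDensity (fun y => f (e.symm y)) := by
    intro f hf
    ext s hs
    have hfe : Measurable fun y => f (e.symm y) := hf.comp e.symm.measurable
    rw [Measure.map_apply e.measurable hs, withDensity_apply _ (e.measurable hs),
      withDensity_apply _ hs, setLIntegral_map hs hfe e.measurable]
    simp
  have hLe : Measurable fun y => L (e.symm y) := hL.comp e.symm.measurable
  have hc : (fun y => L (e.symm y)) ∘ e = L := by ext; simp
  refine ⟨Q.map e, fun y => L (e.symm y), Measure.isProbabilityMeasure_map e.measurable.aemeasurable,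
    hLe, ?_, ?_, ?_, ?_, ?_⟩
  · rw [memLp_map_measure_iff hLe.aestronglyMeasurable
      e.measurable.aemeasurable, hc]
    exact hL2
  · rw [hP, key _ (by fun_prop)]
  · rw [hP', key _ (by fun_prop)]
  · rw [e.measurableEmbedding.integral_map]
    simpa using hm
  · rw [variance_map hLe.aemeasurable e.measurable.aemeasurable, hc]
    exact hv

theorem prod {P₁ P₁' : Measure Ω} {P₂ P₂' : Measure Ω'} {κ₁ m₁ v₁ κ₂ m₂ v₂ : ℝ}
    (h₁ : HellingerTilt P₁ P₁' κ₁ m₁ v₁) (h₂ : HellingerTilt P₂ P₂' κ₂ m₂ v₂) :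
    HellingerTilt (P₁.prod P₂) (P₁'.prod P₂') (κ₁ + κ₂) (m₁ + m₂) (v₁ + v₂) := by
  obtain ⟨Q, L, hQ, hL, hL2, hP, hP', hm, hv⟩ := h₁
  obtain ⟨R, M, hR, hM, hM2, hS, hS', hn, hw⟩ := h₂
  refine ⟨Q.prod R, fun x => L x.1 + M x.2, inferInstance, by fun_prop,
    (hL2.comp_fst R).add (hM2.comp_snd Q), ?_, ?_, ?_, ?_⟩
  · rw [hP, hS, prod_withDensity (by fun_prop) (by fun_prop)]
    congr 1; ext x
    rw [← ENNReal.ofReal_mul (Real.exp_nonneg _), ← Real.exp_add]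
    congr 2; ring
  · rw [hP', hS', prod_withDensity (by fun_prop) (by fun_prop)]
    congr 1; ext x
    rw [← ENNReal.ofReal_mul (Real.exp_nonneg _), ← Real.exp_add]
    congr 2; ring
  · rw [integral_add ((hL2.comp_fst R).integrable (by norm_num))
      ((hM2.comp_snd Q).integrable (by norm_num)), integral_fun_fst, integral_fun_snd]
    simp [hm, hn]
  · rw [variance_add_prod hL2 hM2]
    exact add_le_add hv hw

end HellingerTilt

/-- On a box, the density times the indicator is a product of functions of single coordinates, which
are independent under the product measure, so its integral factorizes. -/
theorem pi_withDensity {ι : Type*} [Fintype ι] {Ω : ι → Type*} [∀ i, MeasurableSpace (Ω i)]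
    (Q : ∀ i, Measure (Ω i)) [∀ i, IsProbabilityMeasure (Q i)] (f : ∀ i, Ω i → ENNReal)
    (hf : ∀ i, Measurable (f i)) [∀ i, SigmaFinite ((Q i).withDensity (f i))] :
    Measure.pi (fun i => (Q i).withDensity (f i))
      = (Measure.pi Q).withDensity (fun x => ∏ i, f i (x i)) := by
  classical
  refine (Measure.pi_eq (μ := fun i => (Q i).withDensity (f i)) fun s hs => ?_)
  rw [withDensity_apply _ (MeasurableSet.univ_pi hs),
    ← lintegral_indicator (MeasurableSet.univ_pi hs)]
  have hg : ∀ i, Measurable ((s i).indicator (f i)) := fun i => (hf i).indicator (hs i)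
  have h1 : (Set.univ.pi s).indicator (fun x => ∏ i, f i (x i))
      = fun x => ∏ i, (s i).indicator (f i) (x i) := by
    ext x
    by_cases hx : x ∈ Set.univ.pi s
    · rw [Set.indicator_of_mem hx]
      exact Finset.prod_congr rfl fun i _ => (Set.indicator_of_mem (hx i trivial) _).symm
    · rw [Set.indicator_of_notMem hx]
      simp only [Set.mem_pi, Set.mem_univ, true_implies, not_forall] at hx
      obtain ⟨i, hi⟩ := hx
      exact (Finset.prod_eq_zero (Finset.mem_univ i) (Set.indicator_of_notMem hi _)).symm
  rw [h1]
  have hind : iIndepFun (fun i (x : ∀ i, Ω i) => (s i).indicator (f i) (x i)) (Measure.pi Q) :=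
    iIndepFun_pi fun i => (hg i).aemeasurable
  rw [lintegral_prod_eq_prod_lintegral_of_indepFun Finset.univ _ hind
    (fun i => (hg i).comp (measurable_pi_apply i))]
  refine Finset.prod_congr rfl fun i _ => ?_
  rw [withDensity_apply _ (hs i), ← lintegral_indicator (hs i)]
  exact (measurePreserving_eval Q i).lintegral_comp (hg i)

theorem HellingerTilt.pi {ι : Type*} [Fintype ι] {Ω : ι → Type*} [∀ i, MeasurableSpace (Ω i)]
    {P P' : ∀ i, Measure (Ω i)} [hp : ∀ i, IsProbabilityMeasure (P i)]
    [hp' : ∀ i, IsProbabilityMeasure (P' i)] {κ m v : ι → ℝ}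
    (h : ∀ i, HellingerTilt (P i) (P' i) (κ i) (m i) (v i)) :
    HellingerTilt (Measure.pi P) (Measure.pi P') (∑ i, κ i) (∑ i, m i) (∑ i, v i) := by
  choose Q L hQ hL hL2 hP hP' hm hv using h
  have hint : ∀ i, Integrable (fun x : ∀ i, Ω i => L i (x i)) (Measure.pi Q) := fun i =>
    integrable_comp_eval ((hL2 i).integrable (by norm_num))
  refine ⟨Measure.pi Q, fun x => ∑ i, L i (x i), inferInstance, by fun_prop, ?_, ?_, ?_, ?_, ?_⟩
  · exact memLp_finsetSum _ fun i _ => (hL2 i).comp_measurePreserving (measurePreserving_eval Q i)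
  · have : ∀ i, SigmaFinite ((Q i).withDensity
        (fun x => ENNReal.ofReal (Real.exp (L i x / 2 - κ i)))) := fun i => by
      rw [← hP i]; infer_instance
    rw [funext hP, pi_withDensity _ _ (fun i => by fun_prop)]
    congr 1; ext x
    rw [← ENNReal.ofReal_prod_of_nonneg (fun i _ => Real.exp_nonneg _), ← Real.exp_sum,
      Finset.sum_sub_distrib, Finset.sum_div]
  · have : ∀ i, SigmaFinite ((Q i).withDensity
        (fun x => ENNReal.ofReal (Real.exp (-L i x / 2 - κ i)))) := fun i => by
      rw [← hP' i]; infer_instance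
    rw [funext hP', pi_withDensity _ _ (fun i => by fun_prop)]
    congr 1; ext x
    rw [← ENNReal.ofReal_prod_of_nonneg (fun i _ => Real.exp_nonneg _), ← Real.exp_sum,
      Finset.sum_sub_distrib, ← Finset.sum_neg_distrib, Finset.sum_div]
  · rw [integral_finsetSum _ fun i _ => hint i]
    refine Finset.sum_congr rfl fun i _ => ?_
    rw [integral_comp_eval (hL i).aestronglyMeasurable, hm i]
  · have h2 := variance_sum_pi (μ := Q) (X := L) hL2
    have h3 : (∑ i, fun ω : ∀ i, Ω i => L i (ω i)) = fun x => ∑ i, L i (x i) := by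
      ext x; simp
    rw [h3] at h2
    rw [h2]
    exact Finset.sum_le_sum fun i _ => hv i

/-- The lower bound for testing `P` against `P'`. -/
theorem HellingerTilt.le_measure_add_measure {Ω : Type*} [MeasurableSpace Ω] {P P' : Measure Ω}
    {κ m v : ℝ} (h : HellingerTilt P P' κ m v) {S S' : Set Ω} (hS : MeasurableSet S)
    (hS' : MeasurableSet S') (hSS' : S ∪ S' = Set.univ) :
    ENNReal.ofReal (Real.exp (-κ - √(v + m ^ 2) / 2)) ≤ P S + P' S' := by
  obtain ⟨Q, L, hQ, hL, hL2, hP, hP', hm, hv⟩ := h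
  -- `g` is the minimum of the two densities; since `S` and `S'` cover the space, its integral is at
  -- most the sum of the errors.
  set g : Ω → ℝ := fun x => Real.exp (-|L x| / 2 - κ) with hg
  have hgm : Measurable g := by fun_prop
  have hLi : Integrable L Q := hL2.integrable (by norm_num)
  have h1 : ∫⁻ x, ENNReal.ofReal (g x) ∂Q ≤ P S + P' S' := by
    rw [hP, hP', withDensity_apply _ hS, withDensity_apply _ hS', ← setLIntegral_univ, ← hSS']
    refine (lintegral_union_le _ _ _).trans (add_le_add ?_ ?_)
    · refine lintegral_mono fun x => ENNReal.ofReal_le_ofReal (Real.exp_le_exp.2 ?_)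
      have := neg_abs_le (L x)
      linarith
    · refine lintegral_mono fun x => ENNReal.ofReal_le_ofReal (Real.exp_le_exp.2 ?_)
      have := le_abs_self (L x)
      linarith
  refine le_trans ?_ h1
  have hgb : ∀ x, ‖g x‖ ≤ Real.exp (-κ) := fun x => by
    rw [Real.norm_of_nonneg (Real.exp_nonneg _)]
    exact Real.exp_le_exp.2 (by have := abs_nonneg (L x); linarith)
  have hgi : Integrable g Q :=
    Integrable.of_bound hgm.aestronglyMeasurable _ (Eventually.of_forall hgb)
  rw [← ofReal_integral_eq_lintegral_ofReal hgi (Eventually.of_forall fun x => Real.exp_nonneg _)]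
  refine ENNReal.ofReal_le_ofReal ?_
  set A := ∫ x, |L x| ∂Q with hA
  -- The variance of `|L|` is nonnegative, so `A ^ 2` is at most the second moment of `L`, itself at
  -- most `v + m ^ 2`.
  have hA2 : A ≤ √(v + m ^ 2) := by
    refine Real.le_sqrt_of_sq_le ?_
    have e1 := variance_nonneg (fun x => |L x|) Q
    have hab : MemLp (fun x => |L x|) 2 Q := hL2.abs
    rw [variance_eq_sub hab] at e1
    have e2 := hv
    rw [variance_eq_sub hL2] at e2
    simp only [Pi.pow_apply, sq_abs] at e1 e2
    rw [hm] at e2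
    linarith
  -- Jensen's inequality by hand: bound the exponential below by its tangent at the mean value `-A /
  -- 2`, then integrate.
  have h3 : Real.exp (-κ - A / 2) * (1 + (A / 2)) - Real.exp (-κ - A / 2) / 2 * A ≤
      ∫ x, g x ∂Q := by
    have : ∫ x, (Real.exp (-κ - A / 2) * (1 + (A / 2)) - Real.exp (-κ - A / 2) / 2 * |L x|) ∂Q
        = Real.exp (-κ - A / 2) * (1 + (A / 2)) - Real.exp (-κ - A / 2) / 2 * A := by
      rw [integral_sub (integrable_const _) (hLi.abs.const_mul _),
        integral_const_mul (Real.exp (-κ - A / 2) / 2), ← hA]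
      simp
    rw [← this]
    refine integral_mono ((integrable_const _).sub (hLi.abs.const_mul _)) hgi fun x => ?_
    have e1 := Real.add_one_le_exp (-|L x| / 2 + A / 2)
    have e2 : g x = Real.exp (-κ - A / 2) * Real.exp (-|L x| / 2 + A / 2) := by
      simp only [hg, ← Real.exp_add]; congr 1; ring
    simp only [e2]
    nlinarith [mul_le_mul_of_nonneg_left e1 (Real.exp_nonneg (-κ - A / 2))]
  refine le_trans (b := Real.exp (-κ - A / 2)) ?_ (le_trans (le_of_eq ?_) h3)
  · exact Real.exp_le_exp.2 (show -κ - √(v + m ^ 2) / 2 ≤ -κ - A / 2 by linarith)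
  · ring

/-! ### Gaussian measures -/

theorem gaussianReal_eq_withDensity (a c : ℝ) :
    gaussianReal a 1 = (gaussianReal c 1).withDensity
      (fun x => ENNReal.ofReal (Real.exp ((a - c) * (x - c) - (a - c) ^ 2 / 2))) := by
  rw [gaussianReal_of_var_ne_zero a one_ne_zero, gaussianReal_of_var_ne_zero c one_ne_zero,
    ← withDensity_mul _ (measurable_gaussianPDF _ _) (by fun_prop)]
  congr 1; ext x
  simp only [Pi.mul_apply, gaussianPDF]
  rw [← ENNReal.ofReal_mul (gaussianPDFReal_nonneg _ _ _)]
  congr 1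
  simp only [gaussianPDFReal]
  rw [mul_assoc _ (Real.exp _), ← Real.exp_add]
  congr 2
  simp only [NNReal.coe_one]
  ring

/-- The normalized geometric mean of two unit-variance Gaussians is the Gaussian at the midpoint.
The log-likelihood ratio is linear and vanishes there, hence the mean zero. -/
theorem hellingerTilt_gaussianReal (a b : ℝ) :
    HellingerTilt (gaussianReal a 1) (gaussianReal b 1) ((a - b) ^ 2 / 8) 0 ((a - b) ^ 2) := by
  have hid : MemLp (fun x : ℝ => x) 2 (gaussianReal ((a + b) / 2) 1) := memLp_id_gaussianReal 2
  have h2 : MemLp (fun x => (a - b) * (x - (a + b) / 2)) 2 (gaussianReal ((a + b) / 2) 1) :=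
    (hid.sub (memLp_const _)).const_mul _
  refine ⟨gaussianReal ((a + b) / 2) 1, fun x => (a - b) * (x - (a + b) / 2), inferInstance,
    by fun_prop, h2, ?_, ?_, ?_, ?_⟩
  · rw [gaussianReal_eq_withDensity a ((a + b) / 2)]
    congr 1; ext x; congr 2; ring
  · rw [gaussianReal_eq_withDensity b ((a + b) / 2)]
    congr 1; ext x; congr 2; ring
  · rw [integral_const_mul, integral_sub (hid.integrable (by norm_num)) (integrable_const _)]
    simp
  · rw [variance_const_mul, variance_sub_const (by fun_prop)]
    have : variance (fun x : ℝ => x) (gaussianReal ((a + b) / 2) 1) = 1 := by simp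
    rw [this, mul_one]

theorem multivariateGaussian_one_eq_map_pi {d : ℕ} (m : EuclideanSpace ℝ (Fin d)) :
    multivariateGaussian m 1 = (Measure.pi fun i => gaussianReal (m i) 1).map
      (MeasurableEquiv.toLp 2 (Fin d → ℝ)) := by
  apply Measure.ext_of_charFun
  ext t
  have : ((MeasurableEquiv.toLp 2 (Fin d → ℝ)) : (Fin d → ℝ) → _) = WithLp.toLp 2 := rfl
  rw [this, charFun_multivariateGaussian Matrix.PosSemidef.one, charFun_pi]
  simp_rw [charFun_gaussianReal, ← Complex.exp_sum]
  congr 1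
  simp [Finset.sum_sub_distrib, PiLp.inner_apply, dotProduct, Finset.sum_div, Finset.mul_sum,
    mul_comm, pow_two]

theorem hellingerTilt_multivariateGaussian {d : ℕ} (a b : EuclideanSpace ℝ (Fin d)) :
    HellingerTilt (multivariateGaussian a 1) (multivariateGaussian b 1)
      (‖a - b‖ ^ 2 / 8) 0 (‖a - b‖ ^ 2) := by
  rw [multivariateGaussian_one_eq_map_pi, multivariateGaussian_one_eq_map_pi]
  have h := (HellingerTilt.pi fun i => hellingerTilt_gaussianReal (a i) (b i)).map
    (MeasurableEquiv.toLp 2 (Fin d → ℝ))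
  simp only [Finset.sum_const_zero, ← Finset.sum_div] at h
  have e : ‖a - b‖ ^ 2 = ∑ i, (a i - b i) ^ 2 := by
    rw [EuclideanSpace.real_norm_sq_eq]; rfl
  rw [e]
  exact h

/-! ### Elementary inequalities -/

/-- This is `1 - 1 / x ≤ log x ≤ x - 1` at `x = s / t`. It controls one outcome's share of the
Bernoulli mean; the first-order terms `s ^ 2 - t ^ 2` of the two outcomes cancel, as probabilities
sum to one. -/
theorem abs_mul_log_sub_le {s t : ℝ} (hs : 0 < s) (ht : 0 < t) :
    |s * t * (2 * Real.log (s / t)) - (s ^ 2 - t ^ 2)| ≤ (s - t) ^ 2 := by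
  have h1 := Real.log_le_sub_one_of_pos (div_pos hs ht)
  have h2 := Real.one_sub_inv_le_log_of_pos (div_pos hs ht)
  have e1 : s * t * (s / t - 1) = s ^ 2 - s * t := by field_simp
  have e2 : s * t * (1 - (s / t)⁻¹) = s * t - t ^ 2 := by field_simp
  have h3 := mul_le_mul_of_nonneg_left h1 (mul_pos hs ht).le
  have h4 := mul_le_mul_of_nonneg_left h2 (mul_pos hs ht).le
  rw [e1] at h3
  rw [e2] at h4
  rw [abs_le]
  constructor <;> nlinarith

/-- Controls the second moment uniformly in `s / t`, so the ratio of `p` to `q` may be unbounded.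
With `y = √(s / t)` the weight is `s * t = (t * y) ^ 2`, and the factor `y` is absorbed through `y *
log y ≤ y ^ 2 - 1` for `y ≥ 1`. -/
theorem mul_log_sq_le {s t : ℝ} (hs : 0 < s) (ht : 0 < t) :
    s * t * (2 * Real.log (s / t)) ^ 2 ≤ 16 * (s - t) ^ 2 := by
  wlog h : t ≤ s generalizing s t with H
  · have := H ht hs (le_of_not_ge h)
    rw [← inv_div, Real.log_inv]
    nlinarith
  set y := √(s / t) with hy
  have hst := div_pos hs ht
  have hyp : 0 < y := Real.sqrt_pos.2 hst
  have hy2 : y ^ 2 = s / t := Real.sq_sqrt hst.le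
  have hy1 : 1 ≤ y := Real.one_le_sqrt.2 ((one_le_div ht).2 h)
  have hs' : s = y ^ 2 * t := by rw [hy2]; field_simp
  have hlog : Real.log (s / t) = 2 * Real.log y := by rw [← hy2, Real.log_pow]; norm_num
  have hl0 : 0 ≤ Real.log y := Real.log_nonneg hy1
  have hl1 := Real.log_le_sub_one_of_pos hyp
  have h3 : Real.log y * y ≤ y ^ 2 - 1 := by nlinarith
  have h4 : (Real.log y * y) ^ 2 ≤ (y ^ 2 - 1) ^ 2 :=
    pow_le_pow_left₀ (mul_nonneg hl0 hyp.le) h3 2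
  rw [hlog, hs']
  have h5 := mul_le_mul_of_nonneg_left h4 (sq_nonneg t)
  nlinarith

/-! ### Bernoulli measures -/

theorem bernoulliMeasure_eq_withDensity (r p : unitInterval) (f : Bool → ℝ)
    (ht : (p : ℝ) = f true * r) (hf : 1 - (p : ℝ) = f false * (1 - r)) (hf0 : ∀ b, 0 ≤ f b) :
    bernoulliMeasure true false p =
      (bernoulliMeasure true false r).withDensity (fun b => ENNReal.ofReal (f b)) := by
  have key : ∀ x : unitInterval, (unitInterval.toNNReal x : ENNReal) = ENNReal.ofReal x := by
    intro x
    rw [ENNReal.ofReal, ENNReal.coe_inj]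
    ext
    simp [x.2.1]
  refine Measure.ext_of_singleton fun b => ?_
  rw [withDensity_apply _ (measurableSet_singleton b), lintegral_singleton]
  cases b
  · rw [bernoulliMeasure_apply_of_notMem_of_mem, bernoulliMeasure_apply_of_notMem_of_mem] <;>
      simp [key, hf, ENNReal.ofReal_mul, hf0]
  · rw [bernoulliMeasure_apply_of_mem_of_notMem, bernoulliMeasure_apply_of_mem_of_notMem] <;>
      simp [key, ht, ENNReal.ofReal_mul, hf0]

theorem hellingerTilt_bernoulliMeasure {p q : unitInterval} {c : ℝ} (hp0 : 0 < (p : ℝ))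
    (hq0 : 0 < (q : ℝ)) (hp : (p : ℝ) ≤ c) (hq : (q : ℝ) ≤ c) (hc : c ≤ 1 / 4) :
    ∃ κ m v : ℝ, HellingerTilt (bernoulliMeasure true false p) (bernoulliMeasure true false q)
      κ m v ∧ 0 ≤ κ ∧ κ ≤ (1 + 4 * c) / (1 - c) * ((√p - √q) ^ 2 / 2) ∧
      |m| ≤ 4 * (√p - √q) ^ 2 ∧ 0 ≤ v ∧ v ≤ 64 * (√p - √q) ^ 2 := by
  obtain ⟨s, hs⟩ : ∃ s, s = √(p : ℝ) := ⟨_, rfl⟩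
  obtain ⟨t, ht⟩ : ∃ s, s = √(q : ℝ) := ⟨_, rfl⟩
  obtain ⟨u, hu⟩ : ∃ s, s = √(1 - (p : ℝ)) := ⟨_, rfl⟩
  obtain ⟨w, hw⟩ : ∃ s, s = √(1 - (q : ℝ)) := ⟨_, rfl⟩
  rw [← hs, ← ht]
  have hs0 : 0 < s := hs ▸ Real.sqrt_pos.2 hp0
  have ht0 : 0 < t := ht ▸ Real.sqrt_pos.2 hq0
  have hu0 : 0 < u := hu ▸ Real.sqrt_pos.2 (by linarith)
  have hw0 : 0 < w := hw ▸ Real.sqrt_pos.2 (by linarith)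
  have hs2 : s ^ 2 = p := hs ▸ Real.sq_sqrt hp0.le
  have ht2 : t ^ 2 = q := ht ▸ Real.sq_sqrt hq0.le
  have hu2 : u ^ 2 = 1 - p := hu ▸ Real.sq_sqrt (by linarith)
  have hw2 : w ^ 2 = 1 - q := hw ▸ Real.sq_sqrt (by linarith)
  have hc0 : 0 < c := by linarith
  have hst := mul_pos hs0 ht0
  have huw := mul_pos hu0 hw0
  -- `B` is the Hellinger affinity, so `κ = -log B`, and the tilted law is Bernoulli with parameter
  -- `s * t / B`.
  obtain ⟨B, hB⟩ : ∃ B, B = s * t + u * w := ⟨_, rfl⟩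
  have hB0 : 0 < B := hB ▸ add_pos hst huw
  have huwc : 1 - c ≤ u * w := by
    refine abs_le_of_sq_le_sq' ?_ huw.le |>.2
    rw [mul_pow, hu2, hw2, pow_two]
    exact mul_le_mul (by linarith) (by linarith) (by linarith) (by linarith)
  have hBc : 1 - c ≤ B := by linarith
  have hB2 : 1 / 2 ≤ B := by linarith
  have hBeq : 1 - B = ((s - t) ^ 2 + (u - w) ^ 2) / 2 := by
    rw [hB]; linarith only [hs2, ht2, hu2, hw2]
  have hB1 : B ≤ 1 := by
    linarith only [hBeq, sq_nonneg (s - t), sq_nonneg (u - w)]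
  -- The outcome "no edge" is of lower order: `u ^ 2 - w ^ 2 = -(s ^ 2 - t ^ 2)`, where `s + t` is
  -- at most `2 √c` while `u + w` is at least 1. Hence `1 - B` is `(s - t) ^ 2 / 2` up to a factor
  -- `1 + 4 * c`.
  have hD : (u - w) ^ 2 ≤ 4 * c * (s - t) ^ 2 := by
    have e1 : (u - w) * (u + w) = -((s - t) * (s + t)) := by linarith only [hs2, ht2, hu2, hw2]
    have e2 : (u - w) ^ 2 * (u + w) ^ 2 = (s - t) ^ 2 * (s + t) ^ 2 := by
      rw [← mul_pow, e1]; ring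
    have e3 : (s + t) ^ 2 ≤ 4 * c := by linarith only [sq_nonneg (s - t), hs2, ht2, hp, hq]
    have e4 : 1 ≤ (u + w) ^ 2 := by linarith only [hu2, hw2, huw, hp, hq, hc]
    linarith only [e2, mul_le_mul_of_nonneg_left e3 (sq_nonneg (s - t)),
      mul_le_mul_of_nonneg_left e4 (sq_nonneg (u - w))]
  have hD' : (u - w) ^ 2 ≤ (s - t) ^ 2 :=
    hD.trans (mul_le_of_le_one_left (sq_nonneg _) (by linarith))
  have hB2' : (s - t) ^ 2 * (1 / 2) ≤ (s - t) ^ 2 * B :=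
    mul_le_mul_of_nonneg_left hB2 (sq_nonneg _)
  have hr : s * t / B ∈ Set.Icc (0 : ℝ) 1 :=
    ⟨by positivity, (div_le_one hB0).2 (by linarith)⟩
  obtain ⟨r, hrt⟩ : ∃ r : unitInterval, (r : ℝ) = s * t / B := ⟨⟨_, hr⟩, rfl⟩
  have hrf : 1 - (r : ℝ) = u * w / B := by rw [hrt, hB]; field_simp; ring
  obtain ⟨L, hLt, hLf⟩ : ∃ L : Bool → ℝ, L true = 2 * Real.log (s / t) ∧
      L false = 2 * Real.log (u / w) :=
    ⟨fun b => if b then 2 * Real.log (s / t) else 2 * Real.log (u / w), rfl, rfl⟩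
  have hint : ∀ f : Bool → ℝ, ∫ b, f b ∂(bernoulliMeasure true false r) =
      (s * t * f true + u * w * f false) / B := by
    intro f
    rw [integral_bernoulliMeasure]
    simp only [smul_eq_mul, hrf]
    rw [hrt]
    ring
  have hL2 : MemLp L 2 (bernoulliMeasure true false r) := MemLp.of_discrete
  have hexp : ∀ x, 0 < x → Real.exp (2 * Real.log x / 2 - -Real.log B) = x * B := by
    intro x hx
    rw [mul_div_cancel_left₀ _ two_ne_zero, sub_neg_eq_add, Real.exp_add, Real.exp_log hx,
      Real.exp_log hB0]
  have hexp' : ∀ x, 0 < x → Real.exp (-(2 * Real.log x) / 2 - -Real.log B) = x⁻¹ * B := by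
    intro x hx
    rw [← hexp _ (inv_pos.2 hx), Real.log_inv, mul_neg]
  refine ⟨-Real.log B, (s * t * L true + u * w * L false) / B,
    (s * t * L true ^ 2 + u * w * L false ^ 2) / B,
    ⟨bernoulliMeasure true false r, L, inferInstance, measurable_of_finite _, hL2, ?_, ?_,
      hint L, ?_⟩, ?_, ?_, ?_,
    div_nonneg (add_nonneg (mul_nonneg hst.le (sq_nonneg _)) (mul_nonneg huw.le (sq_nonneg _)))
      hB0.le, ?_⟩
  · refine bernoulliMeasure_eq_withDensity r p _ ?_ ?_ fun b => Real.exp_nonneg _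
    · simp only [hLt]
      rw [hexp _ (div_pos hs0 ht0), hrt, ← hs2]
      field_simp
    · simp only [hLf]
      rw [hexp _ (div_pos hu0 hw0), hrf, ← hu2]
      field_simp
  · refine bernoulliMeasure_eq_withDensity r q _ ?_ ?_ fun b => Real.exp_nonneg _
    · simp only [hLt]
      rw [hexp' _ (div_pos hs0 ht0), hrt, ← ht2]
      field_simp
    · simp only [hLf]
      rw [hexp' _ (div_pos hu0 hw0), hrf, ← hw2]
      field_simp
  · rw [variance_eq_sub hL2]
    have := hint fun b => L b ^ 2
    simp only [Pi.pow_apply]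
    rw [this]
    exact sub_le_self _ (sq_nonneg _)
  · exact neg_nonneg.2 (Real.log_nonpos hB0.le hB1)
  · have h1 := Real.one_sub_inv_le_log_of_pos hB0
    have h2 : -Real.log B ≤ (1 - B) / B := by
      have : (1 - B) / B = B⁻¹ - 1 := by field_simp
      linarith
    refine h2.trans ?_
    rw [hBeq, div_le_iff₀ hB0, div_mul_eq_mul_div, div_mul_eq_mul_div, le_div_iff₀ (by linarith)]
    have hE : 0 ≤ (1 + 4 * c) * ((s - t) ^ 2 / 2) := by positivity
    have h3 : ((s - t) ^ 2 + (u - w) ^ 2) / 2 ≤ (1 + 4 * c) * ((s - t) ^ 2 / 2) := by linarith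
    calc _ ≤ (1 + 4 * c) * ((s - t) ^ 2 / 2) * (1 - c) :=
          mul_le_mul_of_nonneg_right h3 (by linarith)
      _ ≤ _ := mul_le_mul_of_nonneg_left hBc hE
  · rw [abs_div, abs_of_pos hB0, div_le_iff₀ hB0, hLt, hLf]
    have h1 := abs_le.1 (abs_mul_log_sub_le hs0 ht0)
    have h2 := abs_le.1 (abs_mul_log_sub_le hu0 hw0)
    exact abs_le.2 ⟨by linarith only [h1.1, h2.1, hs2, ht2, hu2, hw2, hD', hB2'],
      by linarith only [h1.2, h2.2, hs2, ht2, hu2, hw2, hD', hB2']⟩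
  · rw [div_le_iff₀ hB0, hLt, hLf]
    linarith only [mul_log_sq_le hs0 ht0, mul_log_sq_le hu0 hw0, hD', hB2']

instance Param.isProbabilityMeasure_law {n K d : ℕ} (θ : Param n K d) :
    IsProbabilityMeasure θ.law := by
  unfold Param.law; infer_instance

/-! ### The laws of two partitions that differ at one node -/

/-- An edge is stored with its smaller endpoint first, so `i` may be either coordinate; this turns a
sum over edges at `i` into a sum over the other nodes. -/
theorem sum_edge_incident {n : ℕ} (i : Fin n) (G : Fin n → ℝ) :
    ∑ e : Edge n, ((if e.1.1 = i then G e.1.2 else 0) + (if e.1.2 = i then G e.1.1 else 0))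
      = (∑ j, G j) - G i := by
  have h1 : ∑ e : Edge n, ((if e.1.1 = i then G e.1.2 else 0) +
      (if e.1.2 = i then G e.1.1 else 0)) = ∑ x : Fin n × Fin n, if x.1 < x.2 then
        ((if x.1 = i then G x.2 else 0) + (if x.2 = i then G x.1 else 0)) else 0 := by
    rw [← Finset.sum_filter]
    exact (Finset.sum_subtype _ (by simp) (fun x : Fin n × Fin n =>
      ((if x.1 = i then G x.2 else 0) + (if x.2 = i then G x.1 else 0)))).symm
  have h2 : ∀ x y : Fin n, (if x < y then
        ((if x = i then G y else 0) + (if y = i then G x else 0)) else 0) =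
      (if x = i then (if i < y then G y else 0) else 0) +
        (if y = i then (if x < i then G x else 0) else 0) := by
    intro x y
    by_cases hx : x = i <;> by_cases hy : y = i <;> simp [hx, hy]
  rw [h1, Fintype.sum_prod_type]
  simp only [h2, Finset.sum_add_distrib]
  rw [Finset.sum_comm]
  simp only [Finset.sum_ite_eq', Finset.mem_univ, if_true]
  rw [← Finset.sum_add_distrib, ← Finset.sum_erase_eq_sub (Finset.mem_univ i),
    ← Finset.filter_ne', Finset.sum_filter]
  refine Finset.sum_congr rfl fun j _ => ?_
  rcases lt_trichotomy i j with h | h | h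
  · simp [h, h.not_gt, h.ne']
  · simp [h]
  · simp [h, h.not_gt, h.ne]

theorem sum_communitySize {n K : ℕ} (z : Fin n → Fin K) {a b : Fin K} (hab : a ≠ b) (c c' : ℝ) :
    ∑ j, (if z j = a then c else if z j = b then c' else 0)
      = communitySize z a * c + communitySize z b * c' := by
  have : ∀ j, (if z j = a then c else if z j = b then c' else 0) =
      (if z j = a then c else 0) + (if z j = b then c' else 0) := by
    intro j
    by_cases h : z j = a
    · simp [h, hab]
    · simp [h]
  simp only [this, Finset.sum_add_distrib, ← Finset.sum_filter, Finset.sum_const, nsmul_eq_mul,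
    communitySize]

/-- Only the edges at `i` and the covariate of `i` change law. An edge to the old community passes
from `p` to `q`, one to the new community from `q` to `p`, which reverses the sign of `m`; all
others are unchanged. The `-1` is there because `i` is not its own neighbour. -/
theorem hellingerTilt_law {n K d : ℕ} {θ θ' : Param n K d} {i : Fin n}
    (hz : ∀ j, j ≠ i → θ'.z j = θ.z j) (hi : θ.z i ≠ θ'.z i) (hμ : θ'.μ = θ.μ) (hp : θ'.p = θ.p)
    (hq : θ'.q = θ.q) {κ m v : ℝ}
    (h : HellingerTilt (bernoulliMeasure true false θ.p) (bernoulliMeasure true false θ.q) κ m v) :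
    HellingerTilt θ.law θ'.law
      ((communitySize θ.z (θ.z i) - 1 + communitySize θ.z (θ'.z i)) * κ
        + ‖θ.μ (θ.z i) - θ.μ (θ'.z i)‖ ^ 2 / 8)
      ((communitySize θ.z (θ.z i) - 1 - communitySize θ.z (θ'.z i)) * m)
      ((communitySize θ.z (θ.z i) - 1 + communitySize θ.z (θ'.z i)) * v
        + ‖θ.μ (θ.z i) - θ.μ (θ'.z i)‖ ^ 2) := by
  obtain ⟨a, ha⟩ : ∃ a, a = θ.z i := ⟨_, rfl⟩
  obtain ⟨b, hb⟩ : ∃ b, b = θ'.z i := ⟨_, rfl⟩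
  rw [← ha, ← hb] at hi ⊢
  set G : ℝ → ℝ → Fin n → ℝ := fun c c' j =>
    if θ.z j = a then c else if θ.z j = b then c' else 0 with hG
  set F : ℝ → ℝ → Edge n → ℝ := fun c c' e =>
    (if e.1.1 = i then G c c' e.1.2 else 0) + (if e.1.2 = i then G c c' e.1.1 else 0) with hF
  have hFs : ∀ c c', ∑ e, F c c' e = communitySize θ.z a * c + communitySize θ.z b * c' - c := by
    intro c c'
    rw [hF, sum_edge_incident, sum_communitySize θ.z hi]
    simp [hG, ← ha]
  have hone : ∀ k, HellingerTilt
      (bernoulliMeasure true false (if a = k then θ.p else θ.q))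
      (bernoulliMeasure true false (if b = k then θ.p else θ.q))
      (if k = a then κ else if k = b then κ else 0) (if k = a then m else if k = b then -m else 0)
      (if k = a then v else if k = b then v else 0) := by
    intro k
    by_cases h1 : k = a
    · subst h1; simpa [hi.symm] using h
    · by_cases h2 : k = b
      · subst h2; simpa [hi.symm, hi] using h.symm
      · simpa [h1, h2, Ne.symm h1, Ne.symm h2] using HellingerTilt.refl _
  have hedge : ∀ e : Edge n, HellingerTilt
      (bernoulliMeasure true false (θ.edgeProb e.1.1 e.1.2))
      (bernoulliMeasure true false (θ'.edgeProb e.1.1 e.1.2))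
      (F κ κ e) (F m (-m) e) (F v v e) := by
    rintro ⟨⟨x, y⟩, hxy⟩
    simp only at hxy
    simp only [hF, Param.edgeProb, hp, hq]
    by_cases hx : x = i
    · subst hx
      simp only [hxy.ne', if_true, if_false, add_zero]
      rw [← ha, ← hb, hz y hxy.ne']
      exact hone _
    · by_cases hy : y = i
      · subst hy
        simp only [hxy.ne, if_true, if_false, zero_add]
        rw [← ha, ← hb, hz x hxy.ne, if_congr (eq_comm (a := θ.z x) (b := a)) rfl rfl,
          if_congr (eq_comm (a := θ.z x) (b := b)) rfl rfl]
        exact hone _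
      · simp only [hx, hy, if_false, add_zero, hz x hx, hz y hy]
        exact HellingerTilt.refl _
  have hnode : ∀ j, HellingerTilt (multivariateGaussian (θ.μ (θ.z j)) 1)
      (multivariateGaussian (θ'.μ (θ'.z j)) 1)
      (if j = i then ‖θ.μ a - θ.μ b‖ ^ 2 / 8 else 0) 0
      (if j = i then ‖θ.μ a - θ.μ b‖ ^ 2 else 0) := by
    intro j
    rw [hμ]
    by_cases hj : j = i
    · subst hj
      rw [← ha, ← hb]
      simpa using hellingerTilt_multivariateGaussian (θ.μ a) (θ.μ b)
    · simpa [hj, hz j hj] using HellingerTilt.refl _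
  have := (HellingerTilt.pi hedge).prod (HellingerTilt.pi hnode)
  rw [hFs, hFs, hFs] at this
  simp only [Finset.sum_ite_eq', Finset.mem_univ, if_true, Finset.sum_const_zero, add_zero] at this
  convert this using 1 <;> first | rfl | ring

/-! ### Partitions -/

theorem exists_communitySize_eq (n : ℕ) {K : ℕ} (hK : 0 < K) :
    ∃ z : Fin n → Fin K, ∀ k, n / K ≤ communitySize z k ∧ communitySize z k ≤ n / K + 1 := by
  refine ⟨fun i => ⟨i % K, Nat.mod_lt _ hK⟩, fun k => ?_⟩
  have h : communitySize (fun i : Fin n => (⟨i % K, Nat.mod_lt _ hK⟩ : Fin K)) k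
      = n.count (· ≡ k [MOD K]) := by
    rw [Nat.count_eq_card_filter_range, communitySize,
      ← Finset.card_map Fin.valEmbedding]
    congr 1
    ext x
    simp only [Finset.mem_map, Finset.mem_filter, Finset.mem_univ, true_and,
      Fin.valEmbedding_apply, Finset.mem_range, Nat.ModEq, Nat.mod_eq_of_lt k.2, Fin.ext_iff]
    exact ⟨by rintro ⟨i, hi, rfl⟩; exact ⟨i.2, hi⟩, fun h => ⟨⟨x, h.1⟩, h.2, rfl⟩⟩
  rw [h, Nat.count_modEq_card n hK]
  split_ifs <;> omega

theorem communitySize_le_add {n K : ℕ} {z z' : Fin n → Fin K} {T : Finset (Fin n)}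
    (h : ∀ i, i ∉ T → z i = z' i) (k : Fin K) :
    communitySize z k ≤ communitySize z' k + T.card := by
  unfold communitySize
  refine (Finset.card_le_card fun i hi => ?_).trans (Finset.card_union_le _ _)
  simp only [Finset.mem_filter, Finset.mem_univ, true_and, Finset.mem_union] at hi ⊢
  by_cases hT : i ∈ T
  · exact Or.inr hT
  · exact Or.inl (by rw [← h i hT, hi])

/-- A nontrivial relabelling moves some label `k` and so errs on all of community `k` off `T`, at
least `T.card` nodes, whereas the identity errs only on `T`. -/
theorem hammingDist_le_hammingDist_perm {n K : ℕ} {z z' : Fin n → Fin K} {T : Finset (Fin n)}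
    (h : ∀ i, i ∉ T → z i = z' i) (hT : ∀ k, 2 * T.card ≤ communitySize z k)
    (σ : Equiv.Perm (Fin K)) :
    hammingDist z z' ≤ hammingDist (fun i => σ (z i)) z' := by
  by_cases hσ : σ = 1
  · subst hσ; simp
  · obtain ⟨k, hk⟩ : ∃ k, σ k ≠ k := by
      by_contra! hc
      exact hσ (Equiv.ext hc)
    have h1 : hammingDist z z' ≤ T.card := by
      refine Finset.card_le_card fun i hi => ?_
      by_contra hiT
      simp [h i hiT] at hi
    have h2 : communitySize z k - T.card ≤ hammingDist (fun i => σ (z i)) z' := by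
      refine (Finset.le_card_sdiff _ _).trans (Finset.card_le_card fun i hi => ?_)
      simp only [Finset.mem_sdiff, Finset.mem_filter, Finset.mem_univ, true_and] at hi ⊢
      rw [← h i hi.2, hi.1]
      exact hk
    have := hT k
    omega

theorem exists_perm_misclustering_eq {n K : ℕ} (y z : Fin n → Fin K) :
    ∃ σ : Equiv.Perm (Fin K), misclustering y z = (hammingDist (fun i => σ (y i)) z : ℝ) / n := by
  obtain ⟨σ, hσ⟩ := exists_eq_ciInf_of_finite
    (f := fun σ : Equiv.Perm (Fin K) => (hammingDist (fun i => σ (y i)) z : ℝ) / n)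
  exact ⟨σ, hσ.symm⟩

/-- Triangle inequality through `y` with its best relabellings `σ` for `z` and `τ` for `z'`. It
shows that replacing an estimator by its nearest point of the cube costs at most a factor 2. -/
theorem hammingDist_le_of_misclustering_le {n K : ℕ} (hn : 0 < n) {y z z' : Fin n → Fin K}
    {T : Finset (Fin n)} (h : ∀ i, i ∉ T → z i = z' i) (hT : ∀ k, 2 * T.card ≤ communitySize z k)
    (hle : misclustering y z ≤ misclustering y z') :
    (hammingDist z z' : ℝ) / (2 * n) ≤ misclustering y z' := by
  obtain ⟨σ, hσ⟩ := exists_perm_misclustering_eq y z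
  obtain ⟨τ, hτ⟩ := exists_perm_misclustering_eq y z'
  have hn' : (0 : ℝ) < n := Nat.cast_pos.2 hn
  rw [hσ, hτ, div_le_div_iff_of_pos_right hn'] at hle
  have h1 := hammingDist_le_hammingDist_perm h hT (τ * σ⁻¹)
  have h2 := hammingDist_triangle (fun i => (τ * σ⁻¹) (z i)) (fun i => τ (y i)) z'
  have h3 : hammingDist (fun i => (τ * σ⁻¹) (z i)) (fun i => τ (y i))
      = hammingDist (fun i => σ (y i)) z := by
    rw [hammingDist_comm]
    have e : (fun i => τ (y i)) = fun i => (τ * σ⁻¹) (σ (y i)) := by ext; simp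
    rw [e]
    exact hammingDist_comp (fun _ => (τ * σ⁻¹ : Equiv.Perm (Fin K)))
      (fun _ => (τ * σ⁻¹).injective)
  have h4 : hammingDist z z' ≤ 2 * hammingDist (fun i => τ (y i)) z' := by
    have : hammingDist (fun i => σ (y i)) z ≤ hammingDist (fun i => τ (y i)) z' := by
      exact_mod_cast hle
    omega
  rw [hτ, div_le_div_iff₀ (by positivity) hn']
  have h5 : (hammingDist z z' : ℝ) ≤ 2 * hammingDist (fun i => τ (y i)) z' := by
    exact_mod_cast h4
  nlinarith

/-! ### Assouad's method -/

/-- The partition that puts the node `i ∈ T` into community `a` or `b` as `s i` says, and agrees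
with `z` off `T`. -/
def switch {n K : ℕ} (z : Fin n → Fin K) (T : Finset (Fin n)) (a b : Fin K) (s : Fin n → Bool) :
    Fin n → Fin K :=
  fun i => if i ∈ T then (if s i then a else b) else z i

theorem switch_of_notMem {n K : ℕ} {z : Fin n → Fin K} {T : Finset (Fin n)} {a b : Fin K}
    {s : Fin n → Bool} {i : Fin n} (hi : i ∉ T) : switch z T a b s i = z i := if_neg hi

/-- Sum over all `s`: flipping coordinate `i` is an involution of the cube, so both terms of `h`
have the same total. Bits outside `T` are idle and only repeat each term. -/
theorem mul_card_mul_le_of_flip {n : ℕ} {T : Finset (Fin n)} {c τ R : ENNReal}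
    {F : (Fin n → Bool) → Fin n → ENNReal}
    (h : ∀ s, ∀ i ∈ T, τ ≤ F s i + F (Function.update s i (!s i)) i)
    (hR : ∀ s, c * ∑ i ∈ T, F s i ≤ R) : c * (T.card * τ) ≤ 2 * R := by
  have hflip : ∀ i, ∑ s, F (Function.update s i (!s i)) i = ∑ s, F s i := by
    intro i
    have hinv : Function.Involutive fun s : Fin n → Bool => Function.update s i (!s i) := by
      intro s; simp
    exact Equiv.sum_comp hinv.toPerm fun s => F s i
  have h1 : ∑ _s : Fin n → Bool, c * (T.card * τ) ≤ ∑ _s : Fin n → Bool, 2 * R := by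
    calc ∑ _s : Fin n → Bool, c * (T.card * τ)
        = ∑ _s : Fin n → Bool, c * ∑ _i ∈ T, τ := by simp [nsmul_eq_mul]
      _ ≤ ∑ s, c * ∑ i ∈ T, (F s i + F (Function.update s i (!s i)) i) := by
          gcongr with s _ i hi
          exact h s i hi
      _ = c * ∑ i ∈ T, ∑ s, (F s i + F (Function.update s i (!s i)) i) := by
          rw [← Finset.mul_sum, Finset.sum_comm]
      _ = c * ∑ i ∈ T, 2 * ∑ s, F s i := by
          simp only [Finset.sum_add_distrib, hflip, two_mul]
      _ = ∑ s, 2 * (c * ∑ i ∈ T, F s i) := by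
          rw [← Finset.mul_sum, Finset.sum_comm, ← Finset.mul_sum, ← Finset.mul_sum,
            mul_left_comm]
      _ ≤ _ := by gcongr with s; exact hR s
  simp only [Finset.sum_const, nsmul_eq_mul] at h1
  exact (ENNReal.mul_le_mul_iff_right (by simp) (by simp)).1 h1

/-- Assouad's method on the hypercube of partitions `switch z T a b s`. -/
theorem le_iSup_risk {n K d : ℕ} (hn : 0 < n) {z : Fin n → Fin K} {T : Finset (Fin n)}
    {a b : Fin K} (hab : a ≠ b) (hT : ∀ k, 3 * T.card ≤ communitySize z k)
    (μ : Fin K → EuclideanSpace ℝ (Fin d)) (p q : unitInterval) {Θ : Set (Param n K d)}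
    (hΘ : ∀ s, (⟨switch z T a b s, μ, p, q⟩ : Param n K d) ∈ Θ) {κ : ℝ}
    (htest : ∀ s, ∀ i ∈ T, ∃ κ' m' v', κ' + √(v' + m' ^ 2) / 2 ≤ κ ∧ HellingerTilt
      (⟨switch z T a b s, μ, p, q⟩ : Param n K d).law
      (⟨switch z T a b (Function.update s i (!s i)), μ, p, q⟩ : Param n K d).law κ' m' v') :
    ENNReal.ofReal (T.card / (4 * n) * Real.exp (-κ)) ≤ minimaxRisk Θ := by
  refine le_iInf₂ fun zhat hzhat => ?_
  have hmem : ∀ y : Fin n → Fin K, ∃ s₀, ∀ s, misclustering y (switch z T a b s₀) ≤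
      misclustering y (switch z T a b s) := fun y =>
    Finite.exists_min fun s => misclustering y (switch z T a b s)
  choose φ hφ using hmem
  -- `ψ` projects the estimator onto the cube: its value is a cube point with least misclustering
  -- relative to `zhat`.
  set ψ : Data n d → Fin n → Fin K := fun ω => switch z T a b (φ (zhat ω)) with hψ
  have hψm : Measurable ψ := (measurable_of_finite fun y => switch z T a b (φ y)).comp hzhat
  have hsz : ∀ s k, 2 * T.card ≤ communitySize (switch z T a b s) k := by
    intro s k
    have := communitySize_le_add (z := z) (z' := switch z T a b s) (T := T)
      (fun i hi => (switch_of_notMem hi).symm) k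
    have := hT k
    omega
  set E : (Fin n → Bool) → Fin n → Set (Data n d) := fun s i =>
    {ω | ψ ω i ≠ switch z T a b s i} with hE
  have hEm : ∀ s i, MeasurableSet (E s i) := fun s i =>
    (((measurable_pi_apply i).comp hψm) (measurableSet_singleton _)).compl
  have hn' : (0 : ℝ) < n := Nat.cast_pos.2 hn
  have key := mul_card_mul_le_of_flip (T := T) (c := ENNReal.ofReal (1 / (2 * n)))
    (τ := ENNReal.ofReal (Real.exp (-κ))) (R := ⨆ θ ∈ Θ, risk zhat θ)
    (F := fun s i => (⟨switch z T a b s, μ, p, q⟩ : Param n K d).law (E s i)) ?_ ?_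
  -- The constant 4 combines a factor 2 from the projection and a factor 2 from pairing `s` with its
  -- flip.
  · have h2 : ENNReal.ofReal (1 / (2 * n)) * (T.card * ENNReal.ofReal (Real.exp (-κ)))
        = 2 * ENNReal.ofReal (T.card / (4 * n) * Real.exp (-κ)) := by
      rw [← ENNReal.ofReal_natCast, ← ENNReal.ofReal_mul (by positivity),
        ← ENNReal.ofReal_mul (by positivity), ← ENNReal.ofReal_ofNat 2,
        ← ENNReal.ofReal_mul (by norm_num)]
      congr 1
      field_simp
      ring
    rw [h2] at key
    exact (ENNReal.mul_le_mul_iff_right (by simp) (by simp)).1 key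
  · intro s i hi
    obtain ⟨κ', m', v', hle, ht⟩ := htest s i hi
    refine le_trans (ENNReal.ofReal_le_ofReal (Real.exp_le_exp.2 ?_))
      (ht.le_measure_add_measure (hEm s i) (hEm (Function.update s i (!s i)) i) ?_)
    · linarith
    · ext ω
      -- The two partitions differ at `i` because `a ≠ b`, so `ψ` cannot be right for both: the
      -- error events cover the space.
      simp only [hE, Set.mem_union, Set.mem_ofPred_eq, Set.mem_univ, iff_true]
      by_contra! hc
      have := hc.1.symm.trans hc.2
      cases hs : s i <;> simp [switch, hi, hs, hab, hab.symm] at this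
  · intro s
    refine le_trans ?_ (le_iSup₂ (f := fun θ _ => risk zhat θ) _ (hΘ s))
    have h3 : ∀ i ∈ T, (⟨switch z T a b s, μ, p, q⟩ : Param n K d).law (E s i)
        = ∫⁻ ω, (E s i).indicator 1 ω ∂(⟨switch z T a b s, μ, p, q⟩ : Param n K d).law :=
      fun i _ => (lintegral_indicator_one (hEm s i)).symm
    rw [Finset.sum_congr rfl h3,
      ← lintegral_finsetSum _ fun i _ => measurable_one.indicator (hEm s i),
      ← lintegral_const_mul _ (Finset.measurable_sum _ fun i _ =>
        measurable_one.indicator (hEm s i))]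
    refine lintegral_mono fun ω => ?_
    have h4 := hammingDist_le_of_misclustering_le hn (y := zhat ω) (T := T)
      (z := ψ ω) (z' := switch z T a b s)
      (fun i hi => by simp only [hψ, switch_of_notMem hi]) (hsz _) (hφ _ s)
    refine le_trans ?_ (ENNReal.ofReal_le_ofReal h4)
    have h5 : ∑ i ∈ T, (E s i).indicator (1 : Data n d → ENNReal) ω ≤
        (hammingDist (ψ ω) (switch z T a b s) : ENNReal) := by
      have : ∀ i, (E s i).indicator (1 : Data n d → ENNReal) ω =
          if ψ ω i ≠ switch z T a b s i then 1 else 0 := fun i => by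
        simp only [Set.indicator_apply, hE, Set.mem_ofPred_eq, Pi.one_apply]
      simp only [this, Finset.sum_boole, hammingDist]
      exact_mod_cast Finset.card_le_card (Finset.filter_subset_filter _ (Finset.subset_univ T))
    refine (mul_le_mul_right h5 _).trans ?_
    rw [← ENNReal.ofReal_natCast, ← ENNReal.ofReal_mul (by positivity)]
    exact le_of_eq (congrArg _ (by ring))

/-! ### Lower bound for fixed `n` -/

theorem natCast_div_bounds (n : ℕ) {K : ℕ} (hK : 0 < K) :
    ((n / K : ℕ) : ℝ) ≤ n / K ∧ (n : ℝ) / K ≤ (n / K : ℕ) + 1 := by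
  refine ⟨Nat.cast_div_le, ?_⟩
  have hK' : (0 : ℝ) < K := Nat.cast_pos.2 hK
  rw [div_le_iff₀ hK']
  rw [mul_comm]
  exact_mod_cast (Nat.lt_mul_div_succ n hK).le

theorem exists_minSepSq_eq {K d : ℕ} (hK : 2 ≤ K) (μ : Fin K → EuclideanSpace ℝ (Fin d)) :
    ∃ a b, a ≠ b ∧ ‖μ a - μ b‖ ^ 2 = minSepSq μ := by
  have : Nonempty {k : Fin K × Fin K // k.1 ≠ k.2} :=
    ⟨⟨(⟨0, by omega⟩, ⟨1, by omega⟩), by simp⟩⟩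
  obtain ⟨⟨⟨a, b⟩, hab⟩, h⟩ := exists_eq_ciInf_of_finite
    (f := fun k : {k : Fin K × Fin K // k.1 ≠ k.2} => ‖μ k.1.1 - μ k.1.2‖ ^ 2)
  exact ⟨a, b, hab, h⟩

/-- The lower bound before the passage to the limit: `M` is the number of nodes whose community is
unknown, `u = n / K`, and `c` bounds the edge probabilities. -/
theorem le_minimaxRisk {n K d M : ℕ} (hn : 0 < n) (hK : 2 ≤ K) {α u c : ℝ}
    (hu : u = n / K) (μ : Fin K → EuclideanSpace ℝ (Fin d)) {p q : ℝ} (hp0 : 0 < p) (hq0 : 0 < q)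
    (hp : p ≤ c) (hq : q ≤ c) (hc : c ≤ 1 / 4) (hM : 3 * (M : ℝ) ≤ u)
    (hlow : u / α ≤ u - 1 - M) (hupp : u + 1 + M ≤ α * u) {Θ : Set (Param n K d)}
    (hΘ : balancedParams α μ p q ⊆ Θ) :
    ENNReal.ofReal (M / (4 * n) * Real.exp (-(minSepSq μ / 8
      + (2 * u + 2 + 2 * M) * ((1 + 4 * c) / (1 - c) * ((√p - √q) ^ 2 / 2))
      + √(minSepSq μ + (2 * u + 2 + 2 * M) * (64 * (√p - √q) ^ 2)
        + ((2 * M + 2) * (4 * (√p - √q) ^ 2)) ^ 2) / 2))) ≤ minimaxRisk Θ := by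
  have hK0 : 0 < K := by omega
  obtain ⟨a, b, hab, hsep⟩ := exists_minSepSq_eq hK μ
  obtain ⟨z, hz⟩ := exists_communitySize_eq n hK0
  obtain ⟨hN1, hN2⟩ := natCast_div_bounds n hK0
  rw [← hu] at hN1 hN2
  have h3M : 3 * M ≤ n / K := by
    rw [Nat.le_div_iff_mul_le hK0]
    rw [hu, le_div_iff₀ (Nat.cast_pos.2 hK0)] at hM
    exact_mod_cast hM
  have hMn : M ≤ (Finset.univ : Finset (Fin n)).card := by
    rw [Finset.card_univ, Fintype.card_fin]
    have := Nat.div_le_self n K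
    omega
  obtain ⟨T, -, hT⟩ := Finset.exists_subset_card_eq hMn
  obtain ⟨P, hP⟩ : ∃ P : unitInterval, (P : ℝ) = p := ⟨⟨p, hp0.le, by linarith⟩, rfl⟩
  obtain ⟨Q, hQ⟩ : ∃ Q : unitInterval, (Q : ℝ) = q := ⟨⟨q, hq0.le, by linarith⟩, rfl⟩
  obtain ⟨κ, m, v, ht, hκ0, hκ, hm, hv0, hv⟩ := hellingerTilt_bernoulliMeasure (p := P) (q := Q)
    (hP ▸ hp0) (hQ ▸ hq0) (hP ▸ hp) (hQ ▸ hq) hc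
  rw [hP, hQ] at hκ hm hv
  have hsz : ∀ s k, ((n / K : ℕ) : ℝ) - M ≤ communitySize (switch z T a b s) k ∧
      (communitySize (switch z T a b s) k : ℝ) ≤ (n / K : ℕ) + 1 + M := by
    intro s k
    have h1 := communitySize_le_add (z := z) (z' := switch z T a b s) (T := T)
      (fun i hi => (switch_of_notMem hi).symm) k
    have h2 := communitySize_le_add (z := switch z T a b s) (z' := z) (T := T)
      (fun i hi => switch_of_notMem hi) k
    rw [hT] at h1 h2
    have h3 := hz k
    rw [sub_le_iff_le_add]
    exact ⟨by exact_mod_cast h3.1.trans h1, by exact_mod_cast h2.trans (by omega)⟩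
  rw [← hT]
  refine le_iSup_risk hn hab (fun k => by rw [hT]; exact h3M.trans (hz k).1) μ P Q
    (fun s => hΘ ⟨fun k => ?_, rfl, hP, hQ⟩) fun s i hi => ?_
  · have := hsz s k
    have e1 : (n : ℝ) / (α * K) = u / α := by rw [hu, div_div, mul_comm]
    have e2 : α * (n : ℝ) / K = α * u := by rw [hu, mul_div_assoc]
    rw [e1, e2]
    exact ⟨by linarith, by linarith⟩
  · set z₁ := switch z T a b s with hz₁
    set z₂ := switch z T a b (Function.update s i (!s i)) with hz₂
    have hne : ∀ j, j ≠ i → z₂ j = z₁ j := by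
      intro j hj
      simp [hz₁, hz₂, switch, hj]
    have hi12 : (z₁ i = a ∧ z₂ i = b) ∨ (z₁ i = b ∧ z₂ i = a) := by
      cases h : s i <;> simp [hz₁, hz₂, switch, hi, h]
    have hnorm : ‖μ (z₁ i) - μ (z₂ i)‖ ^ 2 = minSepSq μ := by
      rcases hi12 with h | h
      · rw [h.1, h.2, hsep]
      · rw [h.1, h.2, norm_sub_rev, hsep]
    have hi' : z₁ i ≠ z₂ i := by
      rcases hi12 with h | h
      · rw [h.1, h.2]; exact hab
      · rw [h.1, h.2]; exact hab.symm
    have htl := hellingerTilt_law (θ := ⟨z₁, μ, P, Q⟩) (θ' := ⟨z₂, μ, P, Q⟩) hne hi' rfl rfl rfl ht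
    simp only [hnorm] at htl
    refine ⟨_, _, _, ?_, htl⟩
    have ha := hsz s (z₁ i)
    have hb := hsz s (z₂ i)
    rw [← hz₁] at ha hb
    rw [hT]
    set A : ℝ := (communitySize z₁ (z₁ i) : ℝ)
    set B : ℝ := (communitySize z₁ (z₂ i) : ℝ)
    -- Switched communities have sizes between `⌊u⌋ - M` and `⌊u⌋ + 1 + M`. This bounds the number
    -- of changed edges, and gives `|A - 1 - B| ≤ 2 * M + 2` for the uncancelled means.
    have hAB : A - 1 + B ≤ 2 * u + 2 + 2 * M := by linarith
    have hM0 : (0 : ℝ) ≤ M := Nat.cast_nonneg M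
    have hu0 : 0 ≤ 2 * u + 2 + 2 * (M : ℝ) := by linarith
    have h1 : (A - 1 + B) * κ ≤ (2 * u + 2 + 2 * M) *
        ((1 + 4 * c) / (1 - c) * ((√p - √q) ^ 2 / 2)) :=
      (mul_le_mul_of_nonneg_right hAB hκ0).trans (mul_le_mul_of_nonneg_left hκ hu0)
    have h2 : (A - 1 + B) * v ≤ (2 * u + 2 + 2 * M) * (64 * (√p - √q) ^ 2) :=
      (mul_le_mul_of_nonneg_right hAB hv0).trans (mul_le_mul_of_nonneg_left hv hu0)
    have h3 : ((A - 1 - B) * m) ^ 2 ≤ ((2 * M + 2) * (4 * (√p - √q) ^ 2)) ^ 2 := by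
      refine sq_le_sq' ?_ ?_ <;>
      have h4 : |(A - 1 - B) * m| ≤ (2 * M + 2) * (4 * (√p - √q) ^ 2) := by
        rw [abs_mul]
        refine mul_le_mul (abs_le.2 ⟨by linarith, by linarith⟩) hm (abs_nonneg _) (by positivity)
      · exact (abs_le.1 h4).1
      · exact (abs_le.1 h4).2
    have h5 := Real.sqrt_le_sqrt (show (A - 1 + B) * v + minSepSq μ + ((A - 1 - B) * m) ^ 2 ≤
      minSepSq μ + (2 * u + 2 + 2 * M) * (64 * (√p - √q) ^ 2)
        + ((2 * M + 2) * (4 * (√p - √q) ^ 2)) ^ 2 by linarith)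
    linarith

/-! ### Passage to the limit -/

/-- The exponent of `le_minimaxRisk` is `(1 + η) x` at most once the remainders are small
compared with `η`. -/
theorem exponent_le {η δ c u M g h x lK lδ : ℝ} (hη : 0 < η) (hη1 : η ≤ 1)
    (hδ : δ ≤ η / 64) (hc : c = η / 64) (hg : 0 ≤ g) (hh : 0 ≤ h) (hM0 : 0 ≤ M)
    (hM : M ≤ δ * u) (hu : 64 / η ≤ u) (hx : x = g / 8 + u * h) (hxη : 1408 / η ^ 2 ≤ x)
    (hlK : lK ≤ η / 8 * x) (hlδ : lδ ≤ η / 8 * x) :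
    lK + lδ + (g / 8 + (2 * u + 2 + 2 * M) * ((1 + 4 * c) / (1 - c) * (h / 2))
      + √(g + (2 * u + 2 + 2 * M) * (64 * h) + ((2 * M + 2) * (4 * h)) ^ 2) / 2)
      ≤ (1 + η) * x := by
  have hu1 : 1 ≤ η / 64 * u := by
    rw [div_le_iff₀ hη] at hu
    linarith
  have hu0 : 0 < u := lt_of_lt_of_le (by positivity) hu
  have hMu : M ≤ η / 64 * u := hM.trans (mul_le_mul_of_nonneg_right hδ hu0.le)
  have hH : 0 ≤ u * h := mul_nonneg hu0.le hh
  have hx0 : 0 ≤ x := by linarith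
  have hHx : u * h ≤ x := by linarith
  have hC : (1 + 4 * c) / (1 - c) ≤ 1 + η / 8 := by
    rw [div_le_iff₀ (by linarith), hc]
    nlinarith
  have h1 : (2 * u + 2 + 2 * M) * h ≤ 2 * ((1 + η / 32) * (u * h)) := by
    nlinarith [mul_le_mul_of_nonneg_right hu1 hh, mul_le_mul_of_nonneg_right hMu hh]
  have hc1 : 0 ≤ (1 + 4 * c) / (1 - c) := by
    refine div_nonneg ?_ ?_ <;> linarith
  have h2 : (2 * u + 2 + 2 * M) * ((1 + 4 * c) / (1 - c) * (h / 2)) ≤ (1 + η / 4) * (u * h) := by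
    calc _ = (1 + 4 * c) / (1 - c) * ((2 * u + 2 + 2 * M) * h / 2) := by ring
      _ ≤ (1 + η / 8) * ((1 + η / 32) * (u * h)) :=
          mul_le_mul hC (by linarith) (by positivity) (by linarith)
      _ = ((1 + η / 8) * (1 + η / 32)) * (u * h) := by ring
      _ ≤ _ := mul_le_mul_of_nonneg_right (by nlinarith) hH
  have h3 : (2 * M + 2) * (4 * h) ≤ η / 4 * x := by
    have e1 : (2 * M + 2) * (4 * h) ≤ (η / 16 * u) * (4 * h) :=
      mul_le_mul_of_nonneg_right (by linarith) (by linarith)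
    have e2 := mul_le_mul_of_nonneg_left hHx hη.le
    nlinarith
  have h4 : √(g + (2 * u + 2 + 2 * M) * (64 * h) + ((2 * M + 2) * (4 * h)) ^ 2) ≤ η / 2 * x := by
    refine Real.sqrt_le_iff.2 ⟨by positivity, ?_⟩
    have e1 : ((2 * M + 2) * (4 * h)) ^ 2 ≤ (η / 4 * x) ^ 2 :=
      pow_le_pow_left₀ (by positivity) h3 2
    have e2 : 1408 ≤ x * η ^ 2 := (div_le_iff₀ (by positivity)).1 hxη
    have e3 := mul_le_mul_of_nonneg_right e2 hx0
    have e4 : η / 32 * (u * h) ≤ 1 * (u * h) := mul_le_mul_of_nonneg_right (by linarith) hH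
    -- With `e1`, what remains is `264 * x ≤ ((η / 2) ^ 2 - (η / 4) ^ 2) * x ^ 2`, which is the
    -- requirement `x ≥ 1408 / η ^ 2`.
    have e5 : g + (2 * u + 2 + 2 * M) * (64 * h) ≤ 264 * x := by nlinarith
    nlinarith
  have h5 : η / 4 * (u * h) ≤ η / 4 * x := mul_le_mul_of_nonneg_left hHx (by linarith)
  have h6 : 0 ≤ η * x := by positivity
  linarith

theorem snrSq_eq {n K d : ℕ} (hn : 1 ≤ n) (μ : Fin K → EuclideanSpace ℝ (Fin d)) {p' q' : ℝ}
    (hp' : 0 ≤ p') (hq' : 0 ≤ q') :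
    snrSq n μ p' q' = minSepSq μ / 8 +
      n / K * (√(p' * Real.log n / n) - √(q' * Real.log n / n)) ^ 2 := by
  have hn0 : (0 : ℝ) < n := by exact_mod_cast hn
  have hl : 0 ≤ Real.log n / n := div_nonneg (Real.log_nonneg (by exact_mod_cast hn)) hn0.le
  rw [snrSq, mul_div_assoc, mul_div_assoc, Real.sqrt_mul hp', Real.sqrt_mul hq', ← sub_mul,
    mul_pow, Real.sq_sqrt hl]
  field_simp

theorem minSepSq_nonneg {K d : ℕ} (μ : Fin K → EuclideanSpace ℝ (Fin d)) : 0 ≤ minSepSq μ :=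
  Real.iInf_nonneg fun _ => sq_nonneg _

theorem exists_tendsto_zero_of_eventually {P : ℝ → ℕ → Prop}
    (hmono : ∀ᶠ n in atTop, ∀ η η', η ≤ η' → P η n → P η' n)
    (h : ∀ η, 0 < η → ∀ᶠ n in atTop, P η n) :
    ∃ ε : ℕ → ℝ, Tendsto ε atTop (𝓝 0) ∧ ∀ᶠ n in atTop, P (ε n) n := by
  set S : ℕ → Set ℝ := fun n => {η | 0 < η ∧ P η n} with hS
  have hbdd : ∀ n, BddBelow (S n) := fun n => ⟨0, fun η hη => hη.1.le⟩
  -- The infimum of the admissible `η` need not be attained; the vanishing term `1 / (n + 1)` puts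
  -- `ε n` strictly above it.
  refine ⟨fun n => sInf (S n) + 1 / ((n : ℝ) + 1), ?_, ?_⟩
  · rw [← add_zero (0 : ℝ)]
    refine Tendsto.add ?_ tendsto_one_div_add_atTop_nhds_zero_nat
    rw [Metric.tendsto_atTop']
    intro η hη
    obtain ⟨N, hN⟩ := eventually_atTop.1 (h (η / 2) (by positivity))
    refine ⟨N, fun n hn => ?_⟩
    have h1 : sInf (S n) ≤ η / 2 := csInf_le (hbdd n) ⟨by positivity, hN n hn.le⟩
    have h2 : 0 ≤ sInf (S n) := Real.sInf_nonneg fun η hη => hη.1.le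
    rw [Real.dist_eq, sub_zero, abs_of_nonneg h2]
    linarith
  · filter_upwards [hmono, h 1 one_pos] with n hn h1
    obtain ⟨η, hη, hlt⟩ := exists_lt_of_csInf_lt (⟨1, one_pos, h1⟩ : (S n).Nonempty)
      (show sInf (S n) < sInf (S n) + 1 / ((n : ℝ) + 1) from lt_add_of_pos_right _ (by positivity))
    exact hn η _ hlt.le hη.2

end CSSBM

theorem mainTheorem3
    (α : ℝ) (hα : 1 < α)
    (K d : ℕ → ℕ) (hK : ∀ n, 2 ≤ K n)
    (hnK : Tendsto (fun n : ℕ => (n : ℝ) / (K n : ℝ)) atTop atTop)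
    (μ : ∀ n, Fin (K n) → EuclideanSpace ℝ (Fin (d n)))
    (p' q' : ℕ → ℝ) (hp' : ∀ n, 0 < p' n) (hq' : ∀ n, 0 < q' n)
    (hp : Tendsto (fun n : ℕ => p' n * Real.log n / n) atTop (𝓝 0))
    (hq : Tendsto (fun n : ℕ => q' n * Real.log n / n) atTop (𝓝 0))
    (hsnr : Tendsto (fun n : ℕ => CSSBM.snrSq n (μ n) (p' n) (q' n) / Real.log (K n)) atTop atTop)
    (Θ : ∀ n, Set (CSSBM.Param n (K n) (d n)))
    (hΘ : ∀ n, CSSBM.balancedParams α (μ n) (p' n * Real.log n / n) (q' n * Real.log n / n) ⊆ Θ n) :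
    ∃ ε : ℕ → ℝ, Tendsto ε atTop (𝓝 0) ∧
      ∀ᶠ n in atTop,
        ENNReal.ofReal (Real.exp (-((1 + ε n) * CSSBM.snrSq n (μ n) (p' n) (q' n))))
          ≤ CSSBM.minimaxRisk (Θ n) := by
  have hlogK : ∀ n, Real.log 2 ≤ Real.log (K n) := fun n =>
    Real.log_le_log two_pos (by exact_mod_cast hK n)
  have hlog2 : 0 < Real.log 2 := Real.log_pos one_lt_two
  -- Since `K ≥ 2`, divergence relative to `log K` forces the ratio itself to diverge.
  have hx : Tendsto (fun n => CSSBM.snrSq n (μ n) (p' n) (q' n)) atTop atTop := by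
    refine tendsto_atTop_mono' _ ?_ (hsnr.const_mul_atTop hlog2)
    filter_upwards [hsnr.eventually_ge_atTop 0] with n hn
    calc _ ≤ Real.log (K n) * (CSSBM.snrSq n (μ n) (p' n) (q' n) / Real.log (K n)) :=
          mul_le_mul_of_nonneg_right (hlogK n) hn
      _ = _ := mul_div_cancel₀ _ (hlog2.trans_le (hlogK n)).ne'
  have hmono : ∀ᶠ n in atTop, ∀ η η' : ℝ, η ≤ η' →
      ENNReal.ofReal (Real.exp (-((1 + η) * CSSBM.snrSq n (μ n) (p' n) (q' n))))
        ≤ CSSBM.minimaxRisk (Θ n) →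
      ENNReal.ofReal (Real.exp (-((1 + η') * CSSBM.snrSq n (μ n) (p' n) (q' n))))
        ≤ CSSBM.minimaxRisk (Θ n) := by
    filter_upwards [hx.eventually_ge_atTop 0] with n hn η η' hle h
    refine le_trans (ENNReal.ofReal_le_ofReal (Real.exp_le_exp.2 (neg_le_neg ?_))) h
    exact mul_le_mul_of_nonneg_right (by linarith) hn
  refine CSSBM.exists_tendsto_zero_of_eventually hmono fun η₀ hη₀ => ?_
  obtain ⟨η, hη, hη1, hηle⟩ : ∃ η : ℝ, 0 < η ∧ η ≤ 1 ∧ η ≤ η₀ :=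
    ⟨min 1 η₀, lt_min one_pos hη₀, min_le_left _ _, min_le_right _ _⟩
  have hα0 : 0 < α := one_pos.trans hα
  have hα1 : 0 < 1 - 1 / α := by rw [sub_pos, div_lt_one hα0]; exact hα
  -- The first bound on `δ` makes the switched nodes negligible in the exponent. The second spends
  -- half of the slack in the balance condition; the other half absorbs the rounding error 1 once `u
  -- ≥ 2 / (1 - 1 / α)`.
  obtain ⟨δ, hδ, hδη, hδα⟩ : ∃ δ : ℝ, 0 < δ ∧ δ ≤ η / 64 ∧ δ ≤ (1 - 1 / α) / 2 :=
    ⟨min (η / 64) ((1 - 1 / α) / 2), lt_min (by positivity) (by positivity), min_le_left _ _,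
      min_le_right _ _⟩
  have hc : (0 : ℝ) < η / 64 := by positivity
  filter_upwards [hmono, eventually_ge_atTop 2, hp.eventually_le_const hc, hq.eventually_le_const hc,
    hnK.eventually_ge_atTop (64 / η), hnK.eventually_ge_atTop (2 / (1 - 1 / α)),
    hnK.eventually_ge_atTop (1 / δ), hx.eventually_ge_atTop (1408 / η ^ 2),
    hsnr.eventually_ge_atTop (8 / η), hx.eventually_ge_atTop (Real.log (8 / δ) / (η / 8))]
    with n hm hn2 hpc hqc hu1 hu2 hu3 hx1 hx2 hx3
  refine hm η η₀ hηle ?_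
  have hn0 : (0 : ℝ) < n := by exact_mod_cast (by omega : 0 < n)
  have hK0 : (0 : ℝ) < K n := by exact_mod_cast (by have := hK n; omega : 0 < K n)
  have hlogn : 0 < Real.log n := Real.log_pos (by exact_mod_cast (by omega : 1 < n))
  obtain ⟨u, hu⟩ : ∃ u : ℝ, u = n / K n := ⟨_, rfl⟩
  rw [← hu] at hu1 hu2 hu3
  have hu0 : 0 < u := lt_of_lt_of_le (by positivity) hu1
  rw [div_le_iff₀ hα1] at hu2
  rw [div_le_iff₀ hδ] at hu3
  obtain ⟨M, hM⟩ : ∃ M : ℕ, M = ⌊δ * u⌋₊ := ⟨_, rfl⟩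
  have hM1 : (M : ℝ) ≤ δ * u := by rw [hM]; exact Nat.floor_le (by positivity)
  -- Rounding down loses at most a factor 2 because `δ * u ≥ 1`.
  have hM2 : δ * u ≤ 2 * M := by
    have h1 := Nat.lt_floor_add_one (δ * u)
    have h2 : (1 : ℝ) ≤ M := by
      rw [hM]
      exact_mod_cast Nat.one_le_floor_iff _ |>.2 (by linarith)
    rw [← hM] at h1
    linarith
  have hMη : (M : ℝ) ≤ 1 / 64 * u := hM1.trans (mul_le_mul_of_nonneg_right (by linarith) hu0.le)
  have hMα : (M : ℝ) ≤ (1 - 1 / α) / 2 * u := hM1.trans (mul_le_mul_of_nonneg_right hδα hu0.le)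
  have hαα : u * (1 - 1 / α) ≤ (α - 1) * u := by
    have : 1 - 1 / α ≤ α - 1 := by
      have e : 1 - 1 / α = (α - 1) / α := by field_simp
      rw [e]
      exact div_le_self (by linarith) hα.le
    nlinarith
  have hdiv : u / α = u * (1 / α) := by ring
  have key := CSSBM.le_minimaxRisk (M := M) (α := α) (c := η / 64) (by omega) (hK n) hu (μ n)
    (p := p' n * Real.log n / n) (q := q' n * Real.log n / n)
    (div_pos (mul_pos (hp' n) hlogn) hn0) (div_pos (mul_pos (hq' n) hlogn) hn0) hpc hqc
    (by linarith) (by linarith) (by rw [hdiv]; linarith) (by linarith) (hΘ n)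
  refine le_trans (ENNReal.ofReal_le_ofReal ?_) key
  have hexp := CSSBM.exponent_le (lK := Real.log (K n)) (lδ := Real.log (8 / δ)) hη hη1 hδη rfl
    (CSSBM.minSepSq_nonneg (μ n))
    (sq_nonneg (√(p' n * Real.log n / n) - √(q' n * Real.log n / n)))
    (Nat.cast_nonneg M) hM1 hu1 (by rw [CSSBM.snrSq_eq (by omega) _ (hp' n).le (hq' n).le, hu]) hx1
    (by
      rw [le_div_iff₀ (hlog2.trans_le (hlogK n)), div_mul_eq_mul_div, div_le_iff₀ hη] at hx2
      linarith)
    (by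
      rw [div_le_iff₀ (by positivity)] at hx3
      linarith)
  -- The prefactor is at least `δ / (8 K)`; its logarithm is absorbed in the exponent because `log
  -- K` and the constant `log (8 / δ)` are both small compared with the ratio.
  have hlog : Real.exp (-(Real.log (K n) + Real.log (8 / δ))) ≤ M / (4 * n) := by
    rw [← Real.log_mul hK0.ne' (by positivity), Real.exp_neg, Real.exp_log (by positivity)]
    have : (n : ℝ) = u * K n := by rw [hu]; field_simp
    have e : (K n * (8 / δ) : ℝ)⁻¹ = δ / (8 * K n) := by field_simp
    rw [e, this, div_le_div_iff₀ (by positivity) (by positivity)]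
    linarith [mul_le_mul_of_nonneg_right hM2 (by positivity : 0 ≤ 4 * (K n : ℝ))]
  calc _ ≤ Real.exp (-(Real.log (K n) + Real.log (8 / δ))) * Real.exp (-_) := by
        rw [← Real.exp_add]
        refine Real.exp_le_exp.2 ?_
        rw [← neg_add]
        exact neg_le_neg hexp
    _ ≤ _ := mul_le_mul_of_nonneg_right hlog (Real.exp_nonneg _)
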